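/- Let $1\le k\le n$ and let $V$ be a $k$-plane distribution of class $C^1$ on $\mathbb{R}^n$, that is, a map assigning to every $x\in\mathbb{R}^n$ a $k$-dimensional linear subspace $V(x)\subseteq\mathbb{R}^n$ such that every point of $\mathbb{R}^n$ has an open neighbourhood on which $V$ is spanned by $k$ vector fields of class $C^1$. Then there exists a closed subset $S$ of $\mathbb{R}^n$ which is an embedded $k$-dimensional submanifold of class $\bigcap_{0<\alpha<1}C^{1,\alpha}$ such that $$\mathscr{H}^k(\tau(S,V))>0,\qquad \tau(S,V):=\{x\in S:\ \mathrm{Tan}(S,x)=V(x)\},$$ where $\mathscr{H}^k$ is the $k$-dimensional Hausdorff measure and $\mathrm{Tan}(S,x)$ is the tangent space of $S$ at $x$. Here $S$ is of class $C^{1,\alpha}$ if every point of $S$ has an open neighbourhood $O$ in $\mathbb{R}^n$ for which there are a $k$-dimensional linear subspace $W$, a relatively open set $U\subseteq W$ and a $C^1$ map $\varphi:U\to W^\perp$ such that $S\cap O=\{w+\varphi(w):w\in U\}$, both $\varphi$ and $D\varphi$ are bounded, and $D\varphi$ is $\alpha$-Hölder continuous on $U$; and $S$ is of class $\bigcap_{0<\alpha<1}C^{1,\alpha}$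 if it is of class $C^{1,\alpha}$ for every $\alpha\in(0,1)$. -/

import Mathlib

open Topology Filter MeasureTheory
open scoped NNReal

/-- Euclidean space `ℝⁿ`. -/
abbrev Euc (n : ℕ) : Type := EuclideanSpace ℝ (Fin n)

/-- `V` is a `k`-plane distribution of class `C¹` on `ℝⁿ`: every `V x` is a `k`-dimensional linear
subspace, and locally `V` is spanned by `k` vector fields of class `C¹`. -/
structure IsC1Distribution {n : ℕ} (k : ℕ) (V : Euc n → Submodule ℝ (Euc n)) : Prop where
  finrank_eq : ∀ x, Module.finrank ℝ (V x) = k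
  locally_spanned : ∀ x, ∃ U : Set (Euc n), IsOpen U ∧ x ∈ U ∧
    ∃ X : Fin k → Euc n → Euc n,
      (∀ i, ContDiffOn ℝ 1 (X i) U) ∧
      ∀ y ∈ U, V y = Submodule.span ℝ (Set.range fun i => X i y)

/-- `φ ∈ C^{1,α}(U)` for an open set `U`: `φ` is `C¹` on `U`, `φ` and `Dφ` are bounded on `U`, and
`Dφ` is `α`-Hölder continuous on `U`. -/
structure IsC1Holder {F G : Type*} [NormedAddCommGroup F] [NormedSpace ℝ F]
    [NormedAddCommGroup G] [NormedSpace ℝ G] (α : ℝ≥0) (φ : F → G) (U : Set F) : Prop where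
  contDiffOn : ContDiffOn ℝ 1 φ U
  bounded : ∃ C : ℝ, ∀ w ∈ U, ‖φ w‖ ≤ C
  bounded_fderiv : ∃ C : ℝ, ∀ w ∈ U, ‖fderiv ℝ φ w‖ ≤ C
  holder_fderiv : ∃ C : ℝ≥0, HolderOnWith C α (fderiv ℝ φ) U

/-- The graph over `U ⊆ W` of a map `φ` from the linear subspace `W` to its orthogonal
complement. -/
def graphOver {n : ℕ} {W : Submodule ℝ (Euc n)} (φ : W → Wᗮ) (U : Set W) : Set (Euc n) :=
  (fun w : W => (w : Euc n) + (φ w : Euc n)) '' U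

/-- `S` is a closed embedded `k`-dimensional submanifold of `ℝⁿ` of class `C^{1,α}`: near each of
its points, `S` coincides with the graph of a `C^{1,α}` map `φ : U ⊆ W → Wᗮ` with `W` a
`k`-dimensional linear subspace and `U` open in `W`. -/
structure IsSubmanifoldC1Holder {n : ℕ} (k : ℕ) (α : ℝ≥0) (S : Set (Euc n)) : Prop where
  isClosed : IsClosed S
  locally_graph : ∀ x ∈ S, ∃ O : Set (Euc n), IsOpen O ∧ x ∈ O ∧
    ∃ W : Submodule ℝ (Euc n), Module.finrank ℝ W = k ∧
      ∃ (U : Set W) (φ : W → Wᗮ), IsOpen U ∧ IsC1Holder α φ U ∧ S ∩ O = graphOver φ U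

/-- The tangent space `Tan(S, x)`: the velocities at `x` of the `C¹` curves in `S` through `x`. -/
def tangentVectors {n : ℕ} (S : Set (Euc n)) (x : Euc n) : Set (Euc n) :=
  {v | ∃ γ : ℝ → Euc n, ContDiffAt ℝ 1 γ 0 ∧ γ 0 = x ∧ (∀ᶠ t in 𝓝 (0 : ℝ), γ t ∈ S) ∧
    HasDerivAt γ v 0}

/-- The tangency set `τ(S, V)` of `S` with respect to `V`. -/
def tangencySet {n : ℕ} (S : Set (Euc n)) (V : Euc n → Submodule ℝ (Euc n)) : Set (Euc n) :=
  {x | x ∈ S ∧ tangentVectors S x = (V x : Set (Euc n))}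

/-!
Near the origin the distribution consists of the graphs of linear maps `A z : W → Wᗮ`, where
`W = V 0` and `A` is of class `C¹` (`IsC1Distribution.exists_graph_near_zero`). A graph
`z = w + φ w` is tangent to `V` at the points where `Dφ(w) = A(w + φ w)`. In general this
overdetermined equation has no solution on an open set, but it can be solved on a set of positive
measure
(`DyadicCorrection.exists_differential_eq_on_fatCantor`).

The map is a series `φ = ∑ uⱼ` on `ℝᵏ`. On the dyadic cube `Q` of side `2⁻ʲ` with corner `p` the
correction is `uⱼ(x) = χ_Q(x) M_Q (x - p)`, where the cutoff `χ_Q` is supported in `Q` and equals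
`1` off a margin of relative width `εⱼ`, and where `M_Q` is the difference between the value of `A`
at `p` (at the current approximation) and its value at the corner of the parent cube. At points that
avoid the margins of all generations every `χ_Q` is `1` and critical, so the derivatives of the
corrections telescope to `A(x, φ x)`. The widths `εⱼ` are a constant times `(j + 1)⁻²`: they are
summable, so the points avoiding all margins, a product of fat Cantor sets, have positive measure
(`DyadicCorrection.volume_fatCantor_pos`).

As `A` is Lipschitz, `M_Q` is of size `2⁻ʲ` up to a power of `j`, so `Duⱼ` is bounded by `2⁻ʲ` and
is Lipschitz with constant `1`, both up to powers of `j`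
(`DyadicCorrection.exists_correction_bound`). Interpolation gives a summable sequence of `α`-Hölder
constants for every `α < 1` (`norm_tsum_fderiv_sub_le`). The `C¹` regularity across the faces of
the cubes is obtained from a Taylor estimate alone (`C11Bound.glue`).

Since the bound on `φ` depends only on the supremum of `A`, rescaling keeps the graph over the
Cantor set in the neighbourhood of the origin where `A` describes `V`. The tangency set projects by
a Lipschitz map onto the product of Cantor sets, so its Hausdorff measure is positive.
-/

/-! ### Maps with bounded and Lipschitz derivative -/

section Calculus

variable {E F G ι : Type*} [NormedAddCommGroup E] [NormedSpace ℝ E]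
  [NormedAddCommGroup F] [NormedSpace ℝ F] [NormedAddCommGroup G] [NormedSpace ℝ G]

/-- Quantitative `C^{1,1}` bounds on the whole space: `‖f‖ ≤ a`, `‖Df‖ ≤ b`, and `Df` is
`c`-Lipschitz. -/
structure C11Bound (f : E → F) (a b c : ℝ) : Prop where
  differentiable : Differentiable ℝ f
  norm_le : ∀ x, ‖f x‖ ≤ a
  norm_fderiv_le : ∀ x, ‖fderiv ℝ f x‖ ≤ b
  norm_fderiv_sub_le : ∀ x y, ‖fderiv ℝ f x - fderiv ℝ f y‖ ≤ c * ‖x - y‖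

theorem C11Bound.mono {f : E → F} {a b c a' b' c' : ℝ} (h : C11Bound f a b c) (ha : a ≤ a')
    (hb : b ≤ b') (hc : c ≤ c') : C11Bound f a' b' c' where
  differentiable := h.differentiable
  norm_le x := (h.norm_le x).trans ha
  norm_fderiv_le x := (h.norm_fderiv_le x).trans hb
  norm_fderiv_sub_le x y := (h.norm_fderiv_sub_le x y).trans (by gcongr)

theorem C11Bound.norm_sub_le {f : E → F} {a b c : ℝ} (h : C11Bound f a b c) (x y : E) :
    ‖f x - f y‖ ≤ b * ‖x - y‖ :=
  convex_univ.norm_image_sub_le_of_norm_fderiv_le (fun z _ => h.differentiable z)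
    (fun z _ => h.norm_fderiv_le z) (Set.mem_univ y) (Set.mem_univ x)

theorem C11Bound.norm_taylor_le {f : E → F} {a b c : ℝ} (h : C11Bound f a b c) (hc : 0 ≤ c)
    (x y : E) : ‖f y - f x - fderiv ℝ f x (y - x)‖ ≤ c * ‖y - x‖ ^ 2 := by
  have := (convex_closedBall x ‖y - x‖).norm_image_sub_le_of_norm_fderiv_le'
    (φ := fderiv ℝ f x) (C := c * ‖y - x‖) (fun z _ => h.differentiable z)
    (fun z hz => (h.norm_fderiv_sub_le z x).trans
      (mul_le_mul_of_nonneg_left (mem_closedBall_iff_norm.1 hz) hc))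
    (Metric.mem_closedBall_self (norm_nonneg _)) (mem_closedBall_iff_norm.2 le_rfl)
  rwa [mul_assoc, ← sq] at this

/-- The class of functions with bounds of the shape `(1, r, r²)` is closed under products, with
the parameters `r` adding up. -/
theorem C11Bound.mul {f g : E → ℝ} {a b : ℝ} (hf : C11Bound f 1 a (a ^ 2))
    (hg : C11Bound g 1 b (b ^ 2)) :
    C11Bound (fun x => f x * g x) 1 (a + b) ((a + b) ^ 2) := by
  have hfd : ∀ x, fderiv ℝ (fun x => f x * g x) x = f x • fderiv ℝ g x + g x • fderiv ℝ f x :=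
    fun x => fderiv_fun_mul (hf.differentiable x) (hg.differentiable x)
  have key : ∀ (u v : ℝ) (L L' : E →L[ℝ] ℝ) {p q p' q' : ℝ}, ‖u‖ ≤ p → ‖L‖ ≤ q → ‖v‖ ≤ p' →
      ‖L'‖ ≤ q' → ‖u • L + v • L'‖ ≤ p * q + p' * q' := by
    intro u v L L' p q p' q' h1 h2 h3 h4
    refine (norm_add_le _ _).trans ?_
    rw [norm_smul, norm_smul]
    have := norm_nonneg u
    have := norm_nonneg v
    gcongr <;> linarith [norm_nonneg u, norm_nonneg v]
  refine ⟨fun x => (hf.differentiable x).mul (hg.differentiable x), fun x => ?_, fun x => ?_,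
    fun x y => ?_⟩
  · rw [norm_mul]
    exact mul_le_one₀ (hf.norm_le x) (norm_nonneg _) (hg.norm_le x)
  · rw [hfd]
    refine (key _ _ _ _ (hf.norm_le x) (hg.norm_fderiv_le x) (hg.norm_le x)
      (hf.norm_fderiv_le x)).trans (le_of_eq (by ring))
  · rw [hfd, hfd]
    have : f x • fderiv ℝ g x + g x • fderiv ℝ f x - (f y • fderiv ℝ g y + g y • fderiv ℝ f y)
        = (f x • (fderiv ℝ g x - fderiv ℝ g y) + g x • (fderiv ℝ f x - fderiv ℝ f y))
          + ((f x - f y) • fderiv ℝ g y + (g x - g y) • fderiv ℝ f y) := by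
      module
    rw [this]
    refine (norm_add_le _ _).trans ?_
    refine (add_le_add
      (key _ _ _ _ (hf.norm_le x) (hg.norm_fderiv_sub_le x y) (hg.norm_le x)
        (hf.norm_fderiv_sub_le x y))
      (key _ _ _ _ (hf.norm_sub_le x y) (hg.norm_fderiv_le y) (hg.norm_sub_le x y)
        (hf.norm_fderiv_le y))).trans (le_of_eq (by ring))

theorem C11Bound.prod {f : ι → E → ℝ} {a : ι → ℝ} (s : Finset ι)
    (h : ∀ i ∈ s, C11Bound (f i) 1 (a i) (a i ^ 2)) :
    C11Bound (fun x => ∏ i ∈ s, f i x) 1 (∑ i ∈ s, a i) ((∑ i ∈ s, a i) ^ 2) := by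
  classical
  induction s using Finset.induction_on with
  | empty => exact ⟨by simp, by simp, by simp, by simp⟩
  | insert i s hi ih =>
    simp only [Finset.prod_insert hi, Finset.sum_insert hi]
    exact (h i (by simp)).mul (ih fun j hj => h j (by simp [hj]))

theorem C11Bound.comp_affine {f : ℝ → ℝ} {a b r : ℝ} (hf : C11Bound f a b (b ^ 2))
    (ℓ : E →L[ℝ] ℝ) (d : ℝ) (hr : ‖ℓ‖ ≤ r) :
    C11Bound (fun x => f (ℓ x + d)) a (b * r) ((b * r) ^ 2) := by
  have hfd : ∀ x, HasFDerivAt (fun x => f (ℓ x + d)) ((fderiv ℝ f (ℓ x + d)).comp ℓ) x :=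
    fun x => (hf.differentiable _).hasFDerivAt.comp x (ℓ.hasFDerivAt.add_const d)
  have hb : 0 ≤ b := (norm_nonneg _).trans (hf.norm_fderiv_le 0)
  have hr0 : 0 ≤ r := (norm_nonneg _).trans hr
  refine ⟨fun x => (hfd x).differentiableAt, fun x => hf.norm_le _, fun x => ?_, fun x y => ?_⟩
  · rw [(hfd x).fderiv]
    refine (ContinuousLinearMap.opNorm_comp_le _ _).trans ?_
    gcongr
    exact hf.norm_fderiv_le _
  · rw [(hfd x).fderiv, (hfd y).fderiv, ← ContinuousLinearMap.sub_comp]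
    refine (ContinuousLinearMap.opNorm_comp_le _ _).trans ?_
    have h1 := hf.norm_fderiv_sub_le (ℓ x + d) (ℓ y + d)
    have h2 : ‖ℓ x + d - (ℓ y + d)‖ ≤ r * ‖x - y‖ := by
      rw [add_sub_add_right_eq_sub, ← map_sub]
      exact ℓ.le_of_opNorm_le hr _
    calc _ ≤ (b ^ 2 * (r * ‖x - y‖)) * r := by
          gcongr
          exact h1.trans (by gcongr)
      _ = _ := by ring

/-- Multiplying a scalar cutoff whose support lies in a ball of radius `R` about `p` by the linear
map `x ↦ x - p`. -/
theorem C11Bound.smul_sub {f : E → ℝ} {b c R : ℝ} (hf : C11Bound f 1 b c) (hR : 0 ≤ R)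
    (hc : 0 ≤ c) (p : E) (h0 : ∀ x, R < ‖x - p‖ → f x = 0)
    (h1 : ∀ x, R < ‖x - p‖ → fderiv ℝ f x = 0) :
    C11Bound (fun x => f x • (x - p)) R (b * R + 1) (c * R + 2 * b) := by
  have hfd : ∀ x, HasFDerivAt (fun x => f x • (x - p))
      (f x • ContinuousLinearMap.id ℝ E + (fderiv ℝ f x).smulRight (x - p)) x := fun x =>
    (hf.differentiable x).hasFDerivAt.smul ((hasFDerivAt_id x).sub_const p)
  have hb : 0 ≤ b := (norm_nonneg _).trans (hf.norm_fderiv_le p)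
  refine ⟨fun x => (hfd x).differentiableAt, fun x => ?_, fun x => ?_, ?_⟩
  · by_cases hx : R < ‖x - p‖
    · simpa [h0 x hx] using hR
    · rw [norm_smul]
      calc _ ≤ 1 * R := by
            gcongr
            · exact hf.norm_le x
            · exact not_lt.1 hx
        _ = R := one_mul R
  · rw [(hfd x).fderiv]
    by_cases hx : R < ‖x - p‖
    · simp only [h0 x hx, h1 x hx, zero_smul, ContinuousLinearMap.zero_smulRight, add_zero,
        norm_zero]
      positivity
    · refine (norm_add_le _ _).trans ?_
      rw [norm_smul, ContinuousLinearMap.norm_smulRight_apply, add_comm]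
      refine add_le_add (mul_le_mul (hf.norm_fderiv_le x) (not_lt.1 hx) (norm_nonneg _) hb) ?_
      exact mul_le_one₀ (hf.norm_le x) (norm_nonneg _) ContinuousLinearMap.norm_id_le
  -- The estimate with `x` in the ball; the general case follows by symmetry.
  · have key : ∀ x y, ‖x - p‖ ≤ R →
        ‖fderiv ℝ (fun x => f x • (x - p)) x - fderiv ℝ (fun x => f x • (x - p)) y‖
          ≤ (c * R + 2 * b) * ‖x - y‖ := by
      intro x y hx
      rw [(hfd x).fderiv, (hfd y).fderiv]
      have : f x • ContinuousLinearMap.id ℝ E + (fderiv ℝ f x).smulRight (x - p)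
          - (f y • ContinuousLinearMap.id ℝ E + (fderiv ℝ f y).smulRight (y - p))
          = (f x - f y) • ContinuousLinearMap.id ℝ E
            + ((fderiv ℝ f x - fderiv ℝ f y).smulRight (x - p)
              + (fderiv ℝ f y).smulRight (x - y)) := by
        ext v
        simp only [add_apply, sub_apply, smul_apply, ContinuousLinearMap.smulRight_apply,
          ContinuousLinearMap.id_apply]
        module
      rw [this]
      have e1 : ‖(f x - f y) • ContinuousLinearMap.id ℝ E‖ ≤ b * ‖x - y‖ := by
        rw [norm_smul]
        exact (mul_le_of_le_one_right (norm_nonneg _) ContinuousLinearMap.norm_id_le).trans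
          (hf.norm_sub_le x y)
      have e2 : ‖(fderiv ℝ f x - fderiv ℝ f y).smulRight (x - p)‖ ≤ (c * ‖x - y‖) * R := by
        rw [ContinuousLinearMap.norm_smulRight_apply]
        exact mul_le_mul (hf.norm_fderiv_sub_le x y) hx (norm_nonneg _) (by positivity)
      have e3 : ‖(fderiv ℝ f y).smulRight (x - y)‖ ≤ b * ‖x - y‖ := by
        rw [ContinuousLinearMap.norm_smulRight_apply]
        gcongr
        exact hf.norm_fderiv_le y
      linarith [norm_add_le ((f x - f y) • ContinuousLinearMap.id ℝ E)
        ((fderiv ℝ f x - fderiv ℝ f y).smulRight (x - p) + (fderiv ℝ f y).smulRight (x - y)),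
        norm_add_le ((fderiv ℝ f x - fderiv ℝ f y).smulRight (x - p))
          ((fderiv ℝ f y).smulRight (x - y))]
    intro x y
    by_cases hx : ‖x - p‖ ≤ R
    · exact key x y hx
    by_cases hy : ‖y - p‖ ≤ R
    · rw [norm_sub_rev, norm_sub_rev x y]
      exact key y x hy
    · rw [not_le] at hx hy
      rw [(hfd x).fderiv, (hfd y).fderiv, h0 x hx, h1 x hx, h0 y hy, h1 y hy]
      simp only [zero_smul, ContinuousLinearMap.zero_smulRight, add_zero, sub_zero, norm_zero]
      positivity

theorem C11Bound.clm_comp {f : E → F} {a b c m : ℝ} (hf : C11Bound f a b c) (M : F →L[ℝ] G)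
    (hM : ‖M‖ ≤ m) : C11Bound (fun x => M (f x)) (m * a) (m * b) (m * c) := by
  have hfd : ∀ x, HasFDerivAt (fun x => M (f x)) (M.comp (fderiv ℝ f x)) x :=
    fun x => M.hasFDerivAt.comp x (hf.differentiable x).hasFDerivAt
  have hm : 0 ≤ m := (norm_nonneg _).trans hM
  refine ⟨fun x => (hfd x).differentiableAt, fun x => ?_, fun x => ?_, fun x y => ?_⟩
  · exact (M.le_of_opNorm_le hM _).trans (by gcongr; exact hf.norm_le x)
  · rw [(hfd x).fderiv]
    refine (ContinuousLinearMap.opNorm_comp_le _ _).trans ?_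
    gcongr
    exact hf.norm_fderiv_le _
  · rw [(hfd x).fderiv, (hfd y).fderiv, ← ContinuousLinearMap.comp_sub, mul_assoc]
    refine (ContinuousLinearMap.opNorm_comp_le _ _).trans ?_
    gcongr
    exact hf.norm_fderiv_sub_le _ _

/-- Gluing functions living on different cells of a partition: `v i` vanishes to first order off
the `i`-th cell, and all `v i` obey the same `C^{1,1}` bounds. No geometry of the cells is needed,
since the Taylor estimate across two cells splits into one estimate for each of them. -/
theorem C11Bound.glue (cell : E → ι) (v : ι → E → F) {a b c : ℝ} (hc : 0 ≤ c)
    (hv : ∀ i, C11Bound (v i) a b c)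
    (h0 : ∀ x y, cell y ≠ cell x → v (cell x) y = 0)
    (h1 : ∀ x y, cell y ≠ cell x → fderiv ℝ (v (cell x)) y = 0) :
    C11Bound (fun x => v (cell x) x) a b (2 * c) ∧
      ∀ x, fderiv ℝ (fun x => v (cell x) x) x = fderiv ℝ (v (cell x)) x := by
  have taylor : ∀ x y, ‖v (cell y) y - v (cell x) x - fderiv ℝ (v (cell x)) x (y - x)‖
      ≤ 2 * c * ‖y - x‖ ^ 2 := by
    intro x y
    have e1 := (hv (cell x)).norm_taylor_le hc x y
    by_cases hxy : cell y = cell x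
    · rw [hxy]
      refine e1.trans ?_
      have : 0 ≤ c * ‖y - x‖ ^ 2 := by positivity
      linarith
    · have e2 := (hv (cell y)).norm_taylor_le hc x y
      rw [h0 y x (Ne.symm hxy), h1 y x (Ne.symm hxy)] at e2
      rw [h0 x y hxy] at e1
      have : v (cell y) y - v (cell x) x - fderiv ℝ (v (cell x)) x (y - x)
          = (v (cell y) y - 0 - (0 : E →L[ℝ] F) (y - x))
            + (0 - v (cell x) x - fderiv ℝ (v (cell x)) x (y - x)) := by
        simp only [zero_apply]
        abel
      rw [this]
      linarith [norm_add_le (v (cell y) y - 0 - (0 : E →L[ℝ] F) (y - x))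
        (0 - v (cell x) x - fderiv ℝ (v (cell x)) x (y - x))]
  have hfd : ∀ x, HasFDerivAt (fun x => v (cell x) x) (fderiv ℝ (v (cell x)) x) x := by
    intro x
    rw [hasFDerivAt_iff_isLittleO]
    refine (Asymptotics.IsBigO.of_bound (2 * c) (g := fun y => ‖y - x‖ ^ 2)
      (Eventually.of_forall fun y => ?_)).trans_isLittleO
      (Asymptotics.isLittleO_pow_sub_sub x one_lt_two)
    rw [Real.norm_of_nonneg (sq_nonneg ‖y - x‖)]
    exact taylor x y
  refine ⟨⟨fun x => (hfd x).differentiableAt, fun x => (hv _).norm_le x, fun x => ?_,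
    fun x y => ?_⟩, fun x => (hfd x).fderiv⟩
  · rw [(hfd x).fderiv]
    exact (hv _).norm_fderiv_le x
  · rw [(hfd x).fderiv, (hfd y).fderiv]
    have e1 := (hv (cell x)).norm_fderiv_sub_le x y
    by_cases hxy : cell y = cell x
    · rw [hxy]
      refine e1.trans ?_
      have : 0 ≤ c * ‖x - y‖ := by positivity
      linarith
    · have e2 := (hv (cell y)).norm_fderiv_sub_le x y
      rw [h1 y x (Ne.symm hxy)] at e2
      rw [h1 x y hxy] at e1
      have : fderiv ℝ (v (cell x)) x - fderiv ℝ (v (cell y)) y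
          = (fderiv ℝ (v (cell x)) x - 0) + (0 - fderiv ℝ (v (cell y)) y) := by abel
      rw [this]
      linarith [norm_add_le (fderiv ℝ (v (cell x)) x - 0) (0 - fderiv ℝ (v (cell y)) y)]

end Calculus

/-! ### A fat Cantor set -/

namespace DyadicCorrection

/-- The smooth step `Real.smoothTransition` has finite `C^{1,1}` bounds because its derivative is
supported in `[0, 1]`. -/
theorem exists_smoothTransition_fderiv_bound : ∃ C : ℝ, 0 ≤ C ∧
    (∀ x, ‖fderiv ℝ Real.smoothTransition x‖ ≤ C) ∧
    ∀ x y, ‖fderiv ℝ Real.smoothTransition x - fderiv ℝ Real.smoothTransition y‖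
      ≤ C * ‖x - y‖ := by
  have hsupp : HasCompactSupport (fderiv ℝ Real.smoothTransition) := by
    refine HasCompactSupport.intro (isCompact_Icc (a := (0 : ℝ)) (b := 1)) fun x hx => ?_
    rw [Set.mem_Icc, not_and_or, not_le, not_le] at hx
    rcases hx with hx | hx
    · have : Real.smoothTransition =ᶠ[𝓝 x] fun _ => 0 := by
        filter_upwards [Iio_mem_nhds hx] with y hy
        exact Real.smoothTransition.zero_of_nonpos (le_of_lt hy)
      rw [this.fderiv_eq, fderiv_fun_const, Pi.zero_apply]
    · have : Real.smoothTransition =ᶠ[𝓝 x] fun _ => 1 := by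
        filter_upwards [Ioi_mem_nhds hx] with y hy
        exact Real.smoothTransition.one_of_one_le (le_of_lt hy)
      rw [this.fderiv_eq, fderiv_fun_const, Pi.zero_apply]
  have hsmooth : ContDiff ℝ 1 (fderiv ℝ Real.smoothTransition) :=
    (Real.smoothTransition.contDiff (n := 2)).fderiv_right (by norm_num [one_add_one_eq_two])
  obtain ⟨K, hK⟩ := hsmooth.lipschitzWith_of_hasCompactSupport hsupp one_ne_zero
  obtain ⟨C, hC⟩ := hsupp.exists_bound_of_continuous hsmooth.continuous
  refine ⟨max C K, le_max_of_le_right K.2, fun x => (hC x).trans (le_max_left _ _),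
    fun x y => (hK.norm_sub_le x y).trans ?_⟩
  gcongr
  exact le_max_right _ _

/-- Half-width, relative to the cell size, of the margins removed in the `j`-th generation. The
decay is polynomial, which costs only powers of `j` in the derivative estimates, and it is summable,
which leaves a set of positive measure. -/
noncomputable def margin (j : ℕ) : ℝ := 1 / (8 * ((j : ℝ) + 1) ^ 2)

theorem margin_pos (j : ℕ) : 0 < margin j := by unfold margin; positivity

/-- The one-dimensional fat Cantor set: the points of `[0, 1)` which in every dyadic generation
stay away from the end points of their cell. -/
def fatCantor : Set ℝ :=
  {t | t ∈ Set.Ico (0 : ℝ) 1 ∧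
    ∀ j : ℕ, margin j ≤ Int.fract (2 ^ j * t) ∧ Int.fract (2 ^ j * t) ≤ 1 - margin j}

theorem volume_removed_le (j : ℕ) :
    volume {t : ℝ | t ∈ Set.Ico (0 : ℝ) 1 ∧
      ¬ (margin j ≤ Int.fract (2 ^ j * t) ∧ Int.fract (2 ^ j * t) ≤ 1 - margin j)}
      ≤ ENNReal.ofReal (2 * margin j) := by
  have hm := margin_pos j
  have h2 : (0 : ℝ) < 2 ^ j := by positivity
  have hsub : {t : ℝ | t ∈ Set.Ico (0 : ℝ) 1 ∧
      ¬ (margin j ≤ Int.fract (2 ^ j * t) ∧ Int.fract (2 ^ j * t) ≤ 1 - margin j)}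
      ⊆ ⋃ m ∈ Finset.range (2 ^ j),
        (Set.Icc ((m : ℝ) / 2 ^ j) ((m + margin j) / 2 ^ j) ∪
          Set.Icc ((m + 1 - margin j) / 2 ^ j) (((m : ℝ) + 1) / 2 ^ j)) := by
    rintro t ⟨⟨ht0, ht1⟩, hn⟩
    have hfl : 0 ≤ ⌊2 ^ j * t⌋ := Int.floor_nonneg.2 (by positivity)
    obtain ⟨m, hm'⟩ := Int.eq_ofNat_of_zero_le hfl
    have hfr : Int.fract (2 ^ j * t) = 2 ^ j * t - m := by
      rw [Int.fract, hm']; simp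
    have hlo : (m : ℝ) ≤ 2 ^ j * t := by
      have := Int.fract_nonneg (2 ^ j * t); linarith
    have hhi : 2 ^ j * t < m + 1 := by
      have := Int.fract_lt_one (2 ^ j * t); linarith
    have hmlt : m < 2 ^ j := by
      have : (m : ℝ) < 2 ^ j := hlo.trans_lt (by nlinarith)
      exact_mod_cast this
    rw [hfr, not_and_or, not_le, not_le] at hn
    simp only [Set.mem_iUnion, Finset.mem_range, Set.mem_union, Set.mem_Icc, div_le_iff₀ h2,
      le_div_iff₀ h2]
    exact ⟨m, hmlt, hn.imp (fun h => ⟨by linarith, by linarith⟩)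
      (fun h => ⟨by linarith, by linarith⟩)⟩
  refine (measure_mono hsub).trans ((measure_biUnion_finset_le _ _).trans ?_)
  have hcell : ∀ m ∈ Finset.range (2 ^ j),
      volume (Set.Icc ((m : ℝ) / 2 ^ j) ((m + margin j) / 2 ^ j) ∪
        Set.Icc ((m + 1 - margin j) / 2 ^ j) (((m : ℝ) + 1) / 2 ^ j))
        ≤ ENNReal.ofReal (2 * margin j / 2 ^ j) := by
    intro m _
    refine (measure_union_le _ _).trans ?_
    rw [Real.volume_Icc, Real.volume_Icc, ← sub_div, ← sub_div, add_sub_cancel_left,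
      sub_sub_cancel, ← ENNReal.ofReal_add (by positivity) (by positivity), ← add_div, ← two_mul]
  refine (Finset.sum_le_sum hcell).trans ?_
  rw [Finset.sum_const, Finset.card_range, nsmul_eq_mul]
  have : ((2 ^ j : ℕ) : ENNReal) = ENNReal.ofReal (2 ^ j) := by
    rw [← ENNReal.ofReal_natCast]; push_cast; rfl
  rw [this, ← ENNReal.ofReal_mul h2.le, mul_div_cancel₀ _ h2.ne']

theorem volume_fatCantor_pos : 0 < volume fatCantor := by
  set B : ℕ → Set ℝ := fun j => {t : ℝ | t ∈ Set.Ico (0 : ℝ) 1 ∧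
      ¬ (margin j ≤ Int.fract (2 ^ j * t) ∧ Int.fract (2 ^ j * t) ≤ 1 - margin j)} with hB
  have hcover : Set.Ico (0 : ℝ) 1 ⊆ fatCantor ∪ ⋃ j, B j := by
    intro t ht
    by_cases h : t ∈ fatCantor
    · exact Or.inl h
    · right
      simp only [fatCantor, Set.mem_ofPred_eq, not_and, not_forall] at h
      obtain ⟨j, hj⟩ := h ht
      exact Set.mem_iUnion.2 ⟨j, ht, fun h => hj h.1 h.2⟩
  have hsum : HasSum (fun j : ℕ => 2 * margin j) (Real.pi ^ 2 / 24) := by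
    have h := ((hasSum_nat_add_iff' 1).2 hasSum_zeta_two).mul_left (1 / 4 : ℝ)
    have e1 : (fun j : ℕ => 1 / 4 * (1 / ((j + 1 : ℕ) : ℝ) ^ 2)) = fun j => 2 * margin j := by
      funext j
      unfold margin
      push_cast
      have : ((j : ℝ) + 1) ≠ 0 := by positivity
      field_simp
      norm_num
    have e2 : 1 / 4 * (Real.pi ^ 2 / 6 - ∑ i ∈ Finset.range 1, 1 / (i : ℝ) ^ 2)
        = Real.pi ^ 2 / 24 := by
      simp
      ring
    rwa [e1, e2] at h
  have hle : volume (⋃ j, B j) ≤ ENNReal.ofReal (Real.pi ^ 2 / 24) := by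
    refine (measure_iUnion_le _).trans ((ENNReal.tsum_le_tsum volume_removed_le).trans ?_)
    rw [← hsum.tsum_eq, ENNReal.ofReal_tsum_of_nonneg
      (fun j => mul_nonneg zero_le_two (margin_pos j).le) hsum.summable]
  by_contra h0
  have h0 : volume fatCantor = 0 := by simpa using h0
  have h1 : (1 : ENNReal) ≤ ENNReal.ofReal (Real.pi ^ 2 / 24) := by
    calc (1 : ENNReal) = volume (Set.Ico (0 : ℝ) 1) := by simp
      _ ≤ volume fatCantor + volume (⋃ j, B j) := (measure_mono hcover).trans (measure_union_le _ _)
      _ ≤ _ := by rw [h0, zero_add]; exact hle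
  rw [ENNReal.one_le_ofReal] at h1
  nlinarith [Real.pi_le_four, Real.pi_pos]

/-! ### Cutoffs on dyadic cubes -/

section Dyadic

variable {k : ℕ}

/-- The lower corner of the dyadic cube of side `2⁻ʲ` containing `x`. -/
noncomputable def base (j : ℕ) (x : Fin k → ℝ) : Fin k → ℝ :=
  fun i => ⌊2 ^ j * x i⌋ / 2 ^ j

theorem sub_base_apply (j : ℕ) (x : Fin k → ℝ) (i : Fin k) :
    x i - base j x i = Int.fract (2 ^ j * x i) * (1 / 2) ^ j := by
  have h : (2 : ℝ) ^ j ≠ 0 := by positivity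
  rw [base, Int.fract, one_div, inv_pow]
  field_simp

theorem sub_base_nonneg (j : ℕ) (x : Fin k → ℝ) (i : Fin k) : 0 ≤ x i - base j x i := by
  rw [sub_base_apply]
  exact mul_nonneg (Int.fract_nonneg _) (by positivity)

theorem sub_base_lt (j : ℕ) (x : Fin k → ℝ) (i : Fin k) : x i - base j x i < (1 / 2) ^ j := by
  rw [sub_base_apply]
  exact mul_lt_of_lt_one_left (by positivity) (Int.fract_lt_one _)

theorem norm_sub_base_le (j : ℕ) (x : Fin k → ℝ) : ‖x - base j x‖ ≤ (1 / 2) ^ j := by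
  rw [pi_norm_le_iff_of_nonneg (by positivity)]
  intro i
  rw [Pi.sub_apply, Real.norm_of_nonneg (sub_base_nonneg j x i)]
  exact (sub_base_lt j x i).le

theorem base_eq_base (j : ℕ) (x z : Fin k → ℝ) (h : ∀ i, 0 ≤ x i - base j z i)
    (h' : ∀ i, x i - base j z i < (1 / 2) ^ j) : base j x = base j z := by
  have h2 : (0 : ℝ) < 2 ^ j := by positivity
  have h1 : (2 : ℝ) ^ j * (1 / 2) ^ j = 1 := by rw [← mul_pow]; norm_num
  have key : ∀ i, ⌊2 ^ j * x i⌋ = ⌊2 ^ j * z i⌋ := by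
    intro i
    have hz : 2 ^ j * base j z i = ⌊2 ^ j * z i⌋ := mul_div_cancel₀ _ h2.ne'
    rw [Int.floor_eq_iff]
    have a1 := mul_nonneg h2.le (h i)
    have a2 := mul_lt_mul_of_pos_left (h' i) h2
    rw [mul_sub, hz] at a1 a2
    constructor <;> linarith
  funext i
  rw [base, base, key]

/-- Dyadic cubes are nested. -/
theorem base_base_succ (j : ℕ) (x : Fin k → ℝ) : base j (base (j + 1) x) = base j x := by
  have h2 : (0 : ℝ) < 2 ^ j := by positivity
  have h1 : (2 : ℝ) ^ j * (1 / 2) ^ j = 1 := by rw [← mul_pow]; norm_num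
  refine base_eq_base j _ _ (fun i => ?_) (fun i => ?_)
  · have : 2 * ⌊2 ^ j * x i⌋ ≤ ⌊2 ^ (j + 1) * x i⌋ := by
      rw [Int.le_floor]
      push_cast
      rw [pow_succ]
      nlinarith [Int.floor_le (2 ^ j * x i)]
    have : (2 : ℝ) * ⌊2 ^ j * x i⌋ ≤ ⌊2 ^ (j + 1) * x i⌋ := by exact_mod_cast this
    rw [base, base, sub_nonneg, pow_succ, div_le_div_iff₀ (by positivity) (by positivity)]
    rw [pow_succ] at this
    nlinarith
  · linarith [sub_base_nonneg (j + 1) x i, sub_base_lt j x i]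

/-- A cutoff for the dyadic cube with lower corner `p` and side `2⁻ʲ`: it vanishes off the open
cube and equals `1` at relative distance at least `margin j` from the faces. -/
noncomputable def cutoff (j : ℕ) (p x : Fin k → ℝ) : ℝ :=
  ∏ i, (Real.smoothTransition ((x i - p i) / (margin j * (1 / 2) ^ j)) *
    Real.smoothTransition (((1 / 2) ^ j - (x i - p i)) / (margin j * (1 / 2) ^ j)))

theorem cutoff_nonneg (j : ℕ) (p x : Fin k → ℝ) : 0 ≤ cutoff j p x :=
  Finset.prod_nonneg fun _ _ =>
    mul_nonneg (Real.smoothTransition.nonneg _) (Real.smoothTransition.nonneg _)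

theorem cutoff_le_one (j : ℕ) (p x : Fin k → ℝ) : cutoff j p x ≤ 1 :=
  Finset.prod_le_one
    (fun _ _ => mul_nonneg (Real.smoothTransition.nonneg _) (Real.smoothTransition.nonneg _))
    fun _ _ => mul_le_one₀ (Real.smoothTransition.le_one _) (Real.smoothTransition.nonneg _)
      (Real.smoothTransition.le_one _)

theorem pos_and_lt_of_cutoff_ne_zero {j : ℕ} {p x : Fin k → ℝ} (h : cutoff j p x ≠ 0)
    (i : Fin k) : 0 < x i - p i ∧ x i - p i < (1 / 2) ^ j := by
  have hm : 0 < margin j * (1 / 2 : ℝ) ^ j := mul_pos (margin_pos j) (by positivity)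
  have h1 := Finset.prod_ne_zero_iff.1 h i (Finset.mem_univ i)
  rw [mul_ne_zero_iff, Ne, Ne, Real.smoothTransition.zero_iff_nonpos,
    Real.smoothTransition.zero_iff_nonpos, not_le, not_le, div_pos_iff_of_pos_right hm,
    div_pos_iff_of_pos_right hm] at h1
  exact ⟨h1.1, sub_pos.1 h1.2⟩

theorem cutoff_eq_zero_of_base_ne {j : ℕ} {x y : Fin k → ℝ} (h : base j y ≠ base j x) :
    cutoff j (base j x) y = 0 := by
  by_contra h0
  exact h (base_eq_base j _ _ (fun i => (pos_and_lt_of_cutoff_ne_zero h0 i).1.le)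
    fun i => (pos_and_lt_of_cutoff_ne_zero h0 i).2)

theorem cutoff_eq_zero_of_lt_norm {j : ℕ} {p x : Fin k → ℝ} (h : (1 / 2) ^ j < ‖x - p‖) :
    cutoff j p x = 0 := by
  by_contra h0
  refine h.not_ge ((pi_norm_le_iff_of_nonneg (by positivity)).2 fun i => ?_)
  obtain ⟨h1, h2⟩ := pos_and_lt_of_cutoff_ne_zero h0 i
  rw [Pi.sub_apply, Real.norm_of_nonneg h1.le]
  exact h2.le

/-- A zero of the cutoff is a minimum, hence a critical point. -/
theorem fderiv_cutoff_of_eq_zero {j : ℕ} {p x : Fin k → ℝ} (h : cutoff j p x = 0) :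
    fderiv ℝ (cutoff j p) x = 0 :=
  IsLocalMin.fderiv_eq_zero (Eventually.of_forall fun y => h ▸ cutoff_nonneg j p y)

/-- A point where the cutoff equals `1` is a maximum, hence a critical point. -/
theorem fderiv_cutoff_of_eq_one {j : ℕ} {p x : Fin k → ℝ} (h : cutoff j p x = 1) :
    fderiv ℝ (cutoff j p) x = 0 :=
  IsLocalMax.fderiv_eq_zero (Eventually.of_forall fun y => h ▸ cutoff_le_one j p y)

theorem cutoff_base_eq_one {x : Fin k → ℝ} (hx : x ∈ Set.pi Set.univ fun _ => fatCantor) (j : ℕ) :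
    cutoff j (base j x) x = 1 := by
  refine Finset.prod_eq_one fun i _ => ?_
  obtain ⟨h1, h2⟩ := (hx i (Set.mem_univ i)).2 j
  have hm := margin_pos j
  have hs : (0 : ℝ) < (1 / 2) ^ j := by positivity
  rw [sub_base_apply, Real.smoothTransition.one_of_one_le, Real.smoothTransition.one_of_one_le,
    one_mul] <;> rw [one_le_div (by positivity)] <;> nlinarith

/-- The building block of a correction: the identity centred at the corner `p`, cut off to the cube
at `p`. -/
noncomputable def bump (j : ℕ) (p x : Fin k → ℝ) : Fin k → ℝ := cutoff j p x • (x - p)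

theorem exists_cutoff_bound (k : ℕ) : ∃ C : ℝ, 0 ≤ C ∧ ∀ (j : ℕ) (p : Fin k → ℝ),
    C11Bound (cutoff j p) 1 (C * ((j : ℝ) + 1) ^ 2 * 2 ^ j)
      ((C * ((j : ℝ) + 1) ^ 2 * 2 ^ j) ^ 2) := by
  obtain ⟨C, hC0, hC1, hC2⟩ := exists_smoothTransition_fderiv_bound
  have hη : C11Bound Real.smoothTransition 1 (C + 1) ((C + 1) ^ 2) :=
    ⟨(Real.smoothTransition.contDiff (n := 1)).differentiable (by simp),
      fun x => by
        rw [Real.norm_of_nonneg (Real.smoothTransition.nonneg x)]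
        exact Real.smoothTransition.le_one x,
      fun x => (hC1 x).trans (by linarith), fun x y => (hC2 x y).trans (by gcongr; nlinarith)⟩
  refine ⟨k * (16 * (C + 1)), by positivity, fun j p => ?_⟩
  have hm := margin_pos j
  set t : ℝ := margin j * (1 / 2) ^ j with ht
  have ht0 : 0 < t := by positivity
  have htinv : t⁻¹ = 8 * ((j : ℝ) + 1) ^ 2 * 2 ^ j := by
    rw [ht, margin, one_div, mul_inv, inv_inv, one_div, inv_pow, inv_inv]
  have hproj : ∀ i : Fin k, ‖(ContinuousLinearMap.proj i : (Fin k → ℝ) →L[ℝ] ℝ)‖ ≤ 1 := fun i =>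
    ContinuousLinearMap.opNorm_le_bound _ zero_le_one fun x => by
      simpa using norm_le_pi_norm x i
  have hle : ∀ (i : Fin k) (s : ℝ), |s| = t⁻¹ →
      ‖s • (ContinuousLinearMap.proj i : (Fin k → ℝ) →L[ℝ] ℝ)‖ ≤ t⁻¹ := by
    intro i s hs
    rw [norm_smul, Real.norm_eq_abs, hs]
    exact mul_le_of_le_one_right (by positivity) (hproj i)
  have hfac : ∀ i : Fin k, C11Bound (fun x : Fin k → ℝ =>
      Real.smoothTransition ((x i - p i) / t) *
        Real.smoothTransition (((1 / 2) ^ j - (x i - p i)) / t))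
      1 ((C + 1) * t⁻¹ + (C + 1) * t⁻¹) (((C + 1) * t⁻¹ + (C + 1) * t⁻¹) ^ 2) := by
    intro i
    have h1 := hη.comp_affine (t⁻¹ • (ContinuousLinearMap.proj i : (Fin k → ℝ) →L[ℝ] ℝ))
      (-(p i / t)) (hle i _ (abs_of_pos (by positivity)))
    have h2 := hη.comp_affine ((-t⁻¹) • (ContinuousLinearMap.proj i : (Fin k → ℝ) →L[ℝ] ℝ))
      (((1 / 2) ^ j + p i) / t) (hle i _ (by rw [abs_neg, abs_of_pos (by positivity)]))
    convert h1.mul h2 using 1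
    funext x
    simp only [smul_apply, ContinuousLinearMap.proj_apply, smul_eq_mul]
    congr 2 <;> ring
  have := C11Bound.prod Finset.univ fun i _ => hfac i
  rw [Finset.sum_const, Finset.card_univ, Fintype.card_fin, nsmul_eq_mul] at this
  have e : (k : ℝ) * ((C + 1) * t⁻¹ + (C + 1) * t⁻¹)
      = k * (16 * (C + 1)) * ((j : ℝ) + 1) ^ 2 * 2 ^ j := by
    rw [htinv]; ring
  rwa [e] at this

theorem fderiv_bump {j : ℕ} {p x : Fin k → ℝ} (h : fderiv ℝ (cutoff j p) x = 0) :
    fderiv ℝ (bump j p) x = cutoff j p x • ContinuousLinearMap.id ℝ (Fin k → ℝ) := by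
  obtain ⟨C, -, hC⟩ := exists_cutoff_bound k
  have := ((hC j p).differentiable x).hasFDerivAt.smul ((hasFDerivAt_id x).sub_const p)
  rw [h, ContinuousLinearMap.zero_smulRight, add_zero] at this
  exact this.fderiv

/-- The building blocks have bounds growing polynomially in `j`, apart from the scaling factor of the
dyadic cubes. -/
theorem exists_bump_bound (k : ℕ) : ∃ D : ℝ, 0 ≤ D ∧ ∀ (j : ℕ) (p : Fin k → ℝ),
    C11Bound (bump j p) ((1 / 2) ^ j) (D * ((j : ℝ) + 1) ^ 2) (D * ((j : ℝ) + 1) ^ 4 * 2 ^ j) := by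
  obtain ⟨C, hC0, hC⟩ := exists_cutoff_bound k
  refine ⟨(C + 1) ^ 2, by positivity, fun j p => ?_⟩
  have h := (hC j p).smul_sub (R := (1 / 2) ^ j) (by positivity) (by positivity) p
    (fun x => cutoff_eq_zero_of_lt_norm)
    (fun x hx => fderiv_cutoff_of_eq_zero (cutoff_eq_zero_of_lt_norm hx))
  have h1 : (2 : ℝ) ^ j * (1 / 2) ^ j = 1 := by rw [← mul_pow]; norm_num
  have hj : (1 : ℝ) ≤ ((j : ℝ) + 1) ^ 2 := one_le_pow₀ (by linarith [Nat.cast_nonneg (α := ℝ) j])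
  have h2 : (0 : ℝ) < 2 ^ j := by positivity
  refine h.mono le_rfl ?_ ?_
  · rw [mul_assoc, h1, mul_one]
    calc C * ((j : ℝ) + 1) ^ 2 + 1 ≤ (C + 1) * ((j : ℝ) + 1) ^ 2 := by linarith
      _ ≤ (C + 1) ^ 2 * ((j : ℝ) + 1) ^ 2 := by
        gcongr
        nlinarith
  · calc _ = C ^ 2 * ((j : ℝ) + 1) ^ 4 * 2 ^ j * (2 ^ j * (1 / 2) ^ j)
          + 2 * C * (((j : ℝ) + 1) ^ 2 * 1) * 2 ^ j := by ring
      _ ≤ C ^ 2 * ((j : ℝ) + 1) ^ 4 * 2 ^ j * 1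
          + 2 * C * (((j : ℝ) + 1) ^ 2 * ((j : ℝ) + 1) ^ 2) * 2 ^ j := by
        rw [h1]
        gcongr
      _ = (C ^ 2 + 2 * C) * (((j : ℝ) + 1) ^ 4 * 2 ^ j) := by ring
      _ ≤ (C + 1) ^ 2 * (((j : ℝ) + 1) ^ 4 * 2 ^ j) := by
        gcongr
        nlinarith
      _ = _ := by ring

end Dyadic

end DyadicCorrection

/-! ### Hölder estimates for series -/

section Series

variable {E G : Type*} [NormedAddCommGroup E] [NormedSpace ℝ E] [NormedAddCommGroup G]
  [NormedSpace ℝ G]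

theorem summable_succ_pow_mul_geometric (m : ℕ) {r : ℝ} (h0 : 0 < r) (h1 : r < 1) :
    Summable fun j : ℕ => ((j : ℝ) + 1) ^ m * r ^ j := by
  have h := (summable_nat_add_iff 1).2
    (summable_pow_mul_geometric_of_norm_lt_one m (r := r) (by rwa [Real.norm_of_nonneg h0.le]))
  refine (h.mul_left r⁻¹).congr fun j => ?_
  push_cast
  rw [pow_succ]
  field_simp

/-- Geometric interpolation between a bound `Q s` and a Lipschitz bound `Q t`. -/
theorem le_mul_rpow_mul_rpow {d Q s t α : ℝ} (hd : 0 ≤ d) (hQ : 0 ≤ Q) (hs : 0 ≤ s) (ht : 0 ≤ t)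
    (h0 : 0 < α) (h1 : α < 1) (hds : d ≤ Q * s) (hdt : d ≤ Q * t) :
    d ≤ Q * s ^ (1 - α) * t ^ α := by
  have split : ∀ {a : ℝ}, 0 ≤ a → a = a ^ (1 - α) * a ^ α := fun {a} ha => by
    rw [← Real.rpow_add_of_nonneg ha (by linarith) h0.le, sub_add_cancel, Real.rpow_one]
  calc d = d ^ (1 - α) * d ^ α := split hd
    _ ≤ (Q * s) ^ (1 - α) * (Q * t) ^ α := by
      gcongr
    _ = (Q ^ (1 - α) * Q ^ α) * s ^ (1 - α) * t ^ α := by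
      rw [Real.mul_rpow hQ hs, Real.mul_rpow hQ ht]; ring
    _ = _ := by rw [← split hQ]

/-- A series whose terms have derivatives that are exponentially small, with Lipschitz constants
growing only polynomially, has a sum whose derivative is `α`-Hölder for every `α < 1`. -/
theorem norm_tsum_fderiv_sub_le {u : ℕ → E → G} {a : ℕ → ℝ} {C : ℝ} {m : ℕ} (hC : 0 ≤ C)
    (hu : ∀ j, C11Bound (u j) (a j) (C * ((j : ℝ) + 1) ^ m * (1 / 2) ^ j) (C * ((j : ℝ) + 1) ^ m))
    [CompleteSpace G] {α : ℝ} (h0 : 0 < α) (h1 : α < 1) :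
    ∃ H : ℝ, 0 ≤ H ∧ ∀ x y,
      ‖∑' j, fderiv ℝ (u j) x - ∑' j, fderiv ℝ (u j) y‖ ≤ H * ‖x - y‖ ^ α := by
  have hr0 : (0 : ℝ) < (1 / 2) ^ (1 - α) := by positivity
  have hr1 : ((1 : ℝ) / 2) ^ (1 - α) < 1 :=
    Real.rpow_lt_one (by norm_num) (by norm_num) (by linarith)
  have hsum : ∀ x, Summable fun j => fderiv ℝ (u j) x := fun x =>
    Summable.of_norm_bounded (g := fun j => C * (((j : ℝ) + 1) ^ m * (1 / 2) ^ j))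
      ((summable_succ_pow_mul_geometric m (by norm_num) (by norm_num)).mul_left C)
      fun j => ((hu j).norm_fderiv_le x).trans_eq (mul_assoc _ _ _)
  have hsr := (summable_succ_pow_mul_geometric m hr0 hr1).mul_left (2 * C)
  refine ⟨∑' j : ℕ, 2 * C * (((j : ℝ) + 1) ^ m * ((1 / 2) ^ (1 - α)) ^ j),
    tsum_nonneg fun j => by positivity, fun x y => ?_⟩
  rw [← (hsum x).tsum_sub (hsum y), ← tsum_mul_right]
  refine tsum_of_norm_bounded (hsr.mul_right _).hasSum fun j => ?_
  have key := le_mul_rpow_mul_rpow (d := ‖fderiv ℝ (u j) x - fderiv ℝ (u j) y‖)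
    (Q := 2 * C * ((j : ℝ) + 1) ^ m) (s := (1 / 2) ^ j) (t := ‖x - y‖) (norm_nonneg _)
    (by positivity) (by positivity) (norm_nonneg _) h0 h1
    ((norm_sub_le _ _).trans
      ((add_le_add ((hu j).norm_fderiv_le x) ((hu j).norm_fderiv_le y)).trans_eq (by ring)))
    (((hu j).norm_fderiv_sub_le x y).trans (by gcongr; linarith))
  refine key.trans_eq ?_
  rw [← Real.rpow_natCast (1 / 2 : ℝ) j, ← Real.rpow_mul (by norm_num), mul_comm (j : ℝ),
    Real.rpow_mul (by norm_num), Real.rpow_natCast]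
  ring

end Series

/-! ### Prescribing the differential on the Cantor set -/

namespace DyadicCorrection

section Construction

variable {k : ℕ} {G : Type*} [NormedAddCommGroup G] [NormedSpace ℝ G]

/-- The state of the iteration after `j` steps: the `j`-th approximation, and the piecewise constant
differential prescribed in the step before (zero at the start). -/
noncomputable def state (A : (Fin k → ℝ) → G → ((Fin k → ℝ) →L[ℝ] G)) :
    ℕ → ((Fin k → ℝ) → G) × ((Fin k → ℝ) → ((Fin k → ℝ) →L[ℝ] G))
  | 0 => (0, 0)
  | j + 1 =>
    (fun x => (state A j).1 x
      + (A (base j x) ((state A j).1 (base j x)) - (state A j).2 (base j x)) (bump j (base j x) x),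
    fun x => A (base j x) ((state A j).1 (base j x)))

/-- The `j`-th approximation. -/
noncomputable def approx (A : (Fin k → ℝ) → G → ((Fin k → ℝ) →L[ℝ] G)) (j : ℕ) :
    (Fin k → ℝ) → G := (state A j).1

/-- The differential that the first `j` corrections add up to on the good set; for `j ≥ 1` it is
constant on the cubes of generation `j - 1`. -/
noncomputable def target (A : (Fin k → ℝ) → G → ((Fin k → ℝ) →L[ℝ] G)) (j : ℕ) :
    (Fin k → ℝ) → ((Fin k → ℝ) →L[ℝ] G) := (state A j).2

/-- The change of the prescribed differential in the step from `j` to `j + 1` on the cube with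
corner `p`. -/
noncomputable def jump (A : (Fin k → ℝ) → G → ((Fin k → ℝ) →L[ℝ] G)) (j : ℕ) (p : Fin k → ℝ) :
    (Fin k → ℝ) →L[ℝ] G := A p (approx A j p) - target A j p

/-- The correction added in the step from `j` to `j + 1`. -/
noncomputable def correction (A : (Fin k → ℝ) → G → ((Fin k → ℝ) →L[ℝ] G)) (j : ℕ)
    (x : Fin k → ℝ) : G := jump A j (base j x) (bump j (base j x) x)

variable {A : (Fin k → ℝ) → G → ((Fin k → ℝ) →L[ℝ] G)}

theorem approx_eq_sum (j : ℕ) (x : Fin k → ℝ) :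
    approx A j x = ∑ i ∈ Finset.range j, correction A i x := by
  induction j with
  | zero => rfl
  | succ j ih => rw [Finset.sum_range_succ, ← ih]; rfl

theorem target_succ (j : ℕ) (x : Fin k → ℝ) :
    target A (j + 1) x = A (base j x) (approx A j (base j x)) := rfl

/-- Since dyadic cubes are nested, the differential prescribed one generation earlier is constant on
the cubes of generation `j`. -/
theorem target_base (j : ℕ) (x : Fin k → ℝ) : target A j (base j x) = target A j x := by
  cases j with
  | zero => rfl
  | succ j => rw [target_succ, target_succ, base_base_succ]

theorem jump_base (j : ℕ) (x : Fin k → ℝ) :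
    jump A j (base j x) = target A (j + 1) x - target A j x := by
  rw [jump, target_base, target_succ]

theorem norm_jump_le_two_mul {C₀ : ℝ} (hA : ∀ x y, ‖A x y‖ ≤ C₀) (j : ℕ) (p : Fin k → ℝ) :
    ‖jump A j p‖ ≤ 2 * C₀ := by
  have h0 : 0 ≤ C₀ := (norm_nonneg _).trans (hA 0 0)
  have ht : ‖target A j p‖ ≤ C₀ := by
    cases j with
    | zero => simpa [target, state] using h0
    | succ j => exact hA _ _
  exact (norm_sub_le _ _).trans (by linarith [hA p (approx A j p)])

/-- The corrections inherit the bounds of the building blocks, scaled by a bound `m` of the jumps, and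
their derivatives can be computed cell by cell. -/
theorem correction_bound {D : ℝ} (hD0 : 0 ≤ D) (hD : ∀ (j : ℕ) (p : Fin k → ℝ),
    C11Bound (bump j p) ((1 / 2) ^ j) (D * ((j : ℝ) + 1) ^ 2) (D * ((j : ℝ) + 1) ^ 4 * 2 ^ j))
    {j : ℕ} {m : ℝ} (hm : ∀ p, ‖jump A j p‖ ≤ m) :
    C11Bound (correction A j) (m * (1 / 2) ^ j) (m * (D * ((j : ℝ) + 1) ^ 2))
      (2 * (m * (D * ((j : ℝ) + 1) ^ 4 * 2 ^ j))) ∧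
    ∀ x, fderiv ℝ (correction A j) x
      = (jump A j (base j x)).comp (fderiv ℝ (bump j (base j x)) x) := by
  have hm0 : 0 ≤ m := (norm_nonneg _).trans (hm 0)
  have hfd : ∀ p x, fderiv ℝ (fun x => jump A j p (bump j p x)) x
      = (jump A j p).comp (fderiv ℝ (bump j p) x) := fun p x =>
    ((jump A j p).hasFDerivAt.comp x ((hD j p).differentiable x).hasFDerivAt).fderiv
  have h := C11Bound.glue (base j) (fun p x => jump A j p (bump j p x)) (by positivity)
    (fun p => (hD j p).clm_comp (jump A j p) (hm p))
    (fun x y hxy => by rw [bump, cutoff_eq_zero_of_base_ne hxy, zero_smul, map_zero])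
    (fun x y hxy => by
      have h0 := cutoff_eq_zero_of_base_ne hxy
      rw [hfd, fderiv_bump (fderiv_cutoff_of_eq_zero h0), h0, zero_smul,
        ContinuousLinearMap.comp_zero])
  exact ⟨h.1, fun x => (h.2 x).trans (hfd _ x)⟩

/-- Bounds on the corrections. The approximations are first seen to have Lipschitz constants of
polynomial growth, using only that `A` is bounded; hence the jumps are exponentially small, since
`A` is Lipschitz. -/
theorem exists_correction_bound {C₀ L : ℝ} (hL : 0 ≤ L) (hA : ∀ x y, ‖A x y‖ ≤ C₀)
    (hA' : ∀ x y x' y', ‖A x y - A x' y'‖ ≤ L * (‖x - x'‖ + ‖y - y'‖)) :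
    ∃ C : ℝ, 0 ≤ C ∧ ∀ j, C11Bound (correction A j) (2 * C₀ * (1 / 2) ^ j)
      (C * ((j : ℝ) + 1) ^ 7 * (1 / 2) ^ j) (C * ((j : ℝ) + 1) ^ 7) := by
  obtain ⟨D, hD0, hD⟩ := exists_bump_bound k
  have h0 : 0 ≤ C₀ := (norm_nonneg _).trans (hA 0 0)
  have crude := fun j => (correction_bound hD0 hD (norm_jump_le_two_mul hA j)).1
  have lip : ∀ j x y, ‖approx A j x - approx A j y‖
      ≤ 2 * C₀ * D * ((j : ℝ) + 1) ^ 3 * ‖x - y‖ := by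
    intro j x y
    rw [approx_eq_sum, approx_eq_sum, ← Finset.sum_sub_distrib]
    have : ∀ i ∈ Finset.range j, ‖correction A i x - correction A i y‖
        ≤ 2 * C₀ * (D * ((j : ℝ) + 1) ^ 2) * ‖x - y‖ := fun i hi =>
      ((crude i).norm_sub_le x y).trans (by
        have : (i : ℝ) ≤ j := by exact_mod_cast (Finset.mem_range.1 hi).le
        gcongr)
    refine (norm_sum_le_of_le _ this).trans ?_
    rw [Finset.sum_const, Finset.card_range, nsmul_eq_mul]
    calc (j : ℝ) * (2 * C₀ * (D * ((j : ℝ) + 1) ^ 2) * ‖x - y‖)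
        ≤ ((j : ℝ) + 1) * (2 * C₀ * (D * ((j : ℝ) + 1) ^ 2) * ‖x - y‖) := by
          gcongr; linarith
      _ = _ := by ring
  set M : ℝ := 2 * C₀ + 2 * (L * (1 + 2 * C₀ + 2 * C₀ * D)) with hM
  have hM0 : 0 ≤ M := by positivity
  have hjump : ∀ j p, ‖jump A j p‖ ≤ M * ((j : ℝ) + 1) ^ 3 * (1 / 2) ^ j := by
    intro j p
    cases j with
    | zero =>
      refine (norm_jump_le_two_mul hA 0 p).trans ?_
      have : 0 ≤ 2 * (L * (1 + 2 * C₀ + 2 * C₀ * D)) := by positivity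
      simp only [Nat.cast_zero, zero_add, one_pow, mul_one, pow_zero]
      linarith
    | succ j =>
      set q := base j p with hq
      have hpq : ‖p - q‖ ≤ (1 / 2) ^ j := norm_sub_base_le j p
      have e1 : ‖approx A (j + 1) p - approx A j q‖
          ≤ 2 * C₀ * (1 / 2) ^ j + 2 * C₀ * D * ((j : ℝ) + 1) ^ 3 * (1 / 2) ^ j := by
        have : approx A (j + 1) p - approx A j q
            = correction A j p + (approx A j p - approx A j q) := by
          rw [approx_eq_sum (j + 1), Finset.sum_range_succ, ← approx_eq_sum]; abel
        rw [this]
        refine (norm_add_le _ _).trans (add_le_add ((crude j).norm_le p) ((lip j p q).trans ?_))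
        gcongr
      have hj : (1 : ℝ) ≤ ((j : ℝ) + 1) ^ 3 :=
        one_le_pow₀ (by linarith [Nat.cast_nonneg (α := ℝ) j])
      have hs : (0 : ℝ) < (1 / 2) ^ j := by positivity
      calc ‖jump A (j + 1) p‖ ≤ L * (‖p - q‖ + ‖approx A (j + 1) p - approx A j q‖) := hA' _ _ _ _
        _ ≤ L * (1 * (1 / 2) ^ j + (2 * C₀ * 1 * (1 / 2) ^ j
            + 2 * C₀ * D * ((j : ℝ) + 1) ^ 3 * (1 / 2) ^ j)) := by
          rw [one_mul, mul_one]
          gcongr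
        _ ≤ L * (((j : ℝ) + 1) ^ 3 * (1 / 2) ^ j + (2 * C₀ * ((j : ℝ) + 1) ^ 3 * (1 / 2) ^ j
            + 2 * C₀ * D * ((j : ℝ) + 1) ^ 3 * (1 / 2) ^ j)) := by
          gcongr
        _ = 2 * (L * (1 + 2 * C₀ + 2 * C₀ * D)) * ((j : ℝ) + 1) ^ 3 * (1 / 2) ^ (j + 1) := by
          rw [pow_succ (1 / 2 : ℝ)]; ring
        _ ≤ M * (((j + 1 : ℕ) : ℝ) + 1) ^ 3 * (1 / 2) ^ (j + 1) := by
          gcongr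
          · rw [hM]; linarith
          · exact_mod_cast Nat.le_succ j
  refine ⟨2 * M * D, by positivity, fun j => ?_⟩
  have fine := (correction_bound hD0 hD (hjump j)).1
  have hj : (1 : ℝ) ≤ (j : ℝ) + 1 := by linarith [Nat.cast_nonneg (α := ℝ) j]
  have h1 : (1 / 2 : ℝ) ^ j * 2 ^ j = 1 := by rw [← mul_pow]; norm_num
  refine ⟨fine.differentiable, (crude j).norm_le, fun x => (fine.norm_fderiv_le x).trans ?_,
    fun x y => (fine.norm_fderiv_sub_le x y).trans (le_of_eq ?_)⟩
  · calc _ = M * D * ((j : ℝ) + 1) ^ 5 * (1 / 2) ^ j := by ring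
      _ ≤ (2 * M * D) * ((j : ℝ) + 1) ^ 7 * (1 / 2) ^ j := by
        gcongr
        · linarith
        · norm_num
  · calc _ = 2 * M * D * ((j : ℝ) + 1) ^ 7 * ((1 / 2) ^ j * 2 ^ j) * ‖x - y‖ := by ring
      _ = _ := by rw [h1, mul_one]

/-- A Lusin-type theorem: the equation `Dφ = A(x, φ)`, which in general has no solution on an open
set, is solved on a product of fat Cantor sets by a map `φ` of class `C^{1,α}` for all `α < 1`. The
bound on `φ` does not depend on the Lipschitz constant of `A`. -/
theorem exists_differential_eq_on_fatCantor [CompleteSpace G] {C₀ L : ℝ} (hL : 0 ≤ L)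
    (hA : ∀ x y, ‖A x y‖ ≤ C₀)
    (hA' : ∀ x y x' y', ‖A x y - A x' y'‖ ≤ L * (‖x - x'‖ + ‖y - y'‖)) :
    ∃ (φ : (Fin k → ℝ) → G) (φ' : (Fin k → ℝ) → ((Fin k → ℝ) →L[ℝ] G)),
      (∀ x, HasFDerivAt φ (φ' x) x) ∧ (∀ x, ‖φ x‖ ≤ 4 * C₀) ∧ (∃ C, ∀ x, ‖φ' x‖ ≤ C) ∧
      (∀ α : ℝ, 0 < α → α < 1 → ∃ H : ℝ, 0 ≤ H ∧ ∀ x y, ‖φ' x - φ' y‖ ≤ H * ‖x - y‖ ^ α) ∧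
      ∀ x ∈ Set.pi Set.univ fun _ : Fin k => fatCantor, φ' x = A x (φ x) := by
  obtain ⟨C, hC0, hC⟩ := exists_correction_bound hL hA hA'
  obtain ⟨D, hD0, hD⟩ := exists_bump_bound k
  have hgeom : HasSum (fun j : ℕ => 2 * C₀ * (1 / 2 : ℝ) ^ j) (4 * C₀) := by
    have := hasSum_geometric_two.mul_left (2 * C₀)
    rwa [mul_right_comm, show (2 : ℝ) * 2 = 4 by norm_num] at this
  have hs : Summable fun j : ℕ => C * ((j : ℝ) + 1) ^ 7 * (1 / 2) ^ j :=
    ((summable_succ_pow_mul_geometric 7 (r := 1 / 2) (by norm_num) (by norm_num)).mul_left C).congr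
      fun j => (mul_assoc _ _ _).symm
  have hder : ∀ x, HasFDerivAt (fun x => ∑' j, correction A j x)
      (∑' j, fderiv ℝ (correction A j) x) x :=
    hasFDerivAt_tsum hs (fun j x => ((hC j).differentiable x).hasFDerivAt)
      (fun j x => (hC j).norm_fderiv_le x) (x₀ := 0)
      (Summable.of_norm_bounded hgeom.summable fun j => (hC j).norm_le 0)
  refine ⟨fun x => ∑' j, correction A j x, fun x => ∑' j, fderiv ℝ (correction A j) x, hder,
    fun x => tsum_of_norm_bounded hgeom fun j => (hC j).norm_le x,
    ⟨_, fun x => tsum_of_norm_bounded hs.hasSum fun j => (hC j).norm_fderiv_le x⟩,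
    fun α h0 h1 => norm_tsum_fderiv_sub_le hC0 hC h0 h1, fun x hx => ?_⟩
  set φ : (Fin k → ℝ) → G := fun x => ∑' j, correction A j x with hφ
  -- On the good set the derivatives of the corrections telescope.
  have hfd : ∀ j, fderiv ℝ (correction A j) x = target A (j + 1) x - target A j x := by
    intro j
    have h1 := cutoff_base_eq_one hx j
    rw [(correction_bound hD0 hD (norm_jump_le_two_mul hA j)).2,
      fderiv_bump (fderiv_cutoff_of_eq_one h1), h1, one_smul, ContinuousLinearMap.comp_id,
      jump_base]
  have hpart : ∀ N, ∑ j ∈ Finset.range N, fderiv ℝ (correction A j) x = target A N x := by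
    intro N
    rw [Finset.sum_congr rfl fun j _ => hfd j, Finset.sum_range_sub (fun j => target A j x)]
    exact sub_zero _
  have hlim1 : Tendsto (fun N => target A N x) atTop
      (𝓝 (∑' j, fderiv ℝ (correction A j) x)) := by
    simp only [← hpart]
    exact (Summable.of_norm_bounded hs fun j => (hC j).norm_fderiv_le x).hasSum.tendsto_sum_nat
  have hbase : Tendsto (fun N => base N x) atTop (𝓝 x) := by
    rw [tendsto_iff_norm_sub_tendsto_zero]
    refine squeeze_zero (fun _ => norm_nonneg _)
      (fun N => (norm_sub_rev _ _).trans_le (norm_sub_base_le N x))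
      (tendsto_pow_atTop_nhds_zero_of_lt_one (by norm_num) (by norm_num))
  have happ : Tendsto (fun N => approx A N (base N x)) atTop (𝓝 (φ x)) := by
    have hunif := tendstoUniformly_tsum_nat hgeom.summable fun j x => (hC j).norm_le x
    have := hunif.tendsto_comp (hder x).continuousAt hbase
    simpa only [← approx_eq_sum] using this
  have hlim2 : Tendsto (fun N => target A (N + 1) x) atTop (𝓝 (A x (φ x))) := by
    rw [tendsto_iff_norm_sub_tendsto_zero]
    refine squeeze_zero (fun _ => norm_nonneg _)
      (fun N => hA' (base N x) (approx A N (base N x)) x (φ x)) ?_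
    have := ((tendsto_iff_norm_sub_tendsto_zero.1 hbase).add
      (tendsto_iff_norm_sub_tendsto_zero.1 happ)).const_mul L
    simpa using this
  exact tendsto_nhds_unique ((tendsto_add_atTop_iff_nat 1).2 hlim1) hlim2

end Construction

end DyadicCorrection

open DyadicCorrection

/-! ### Distributions and graphs -/

section Extension

variable {E H : Type*} [NormedAddCommGroup E] [NormedSpace ℝ E] [FiniteDimensional ℝ E]
  [NormedAddCommGroup H] [NormedSpace ℝ H]

theorem ContDiffAt.exists_bounded_lipschitz_eventuallyEq {A : E → H} {x₀ : E}
    (hA : ContDiffAt ℝ 1 A x₀) :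
    ∃ (B : E → H) (C : ℝ) (L : ℝ≥0), (∀ x, ‖B x‖ ≤ C) ∧ LipschitzWith L B ∧ B =ᶠ[𝓝 x₀] A := by
  obtain ⟨δ, hδ, hball⟩ := Metric.eventually_nhds_iff_ball.1 (hA.eventually (by simp))
  let f : ContDiffBump x₀ := ⟨δ / 3, δ / 2, by positivity, by linarith⟩
  have hcs : HasCompactSupport fun x => f x • A x := f.hasCompactSupport.smul_right
  have hsm : ContDiff ℝ 1 fun x => f x • A x := by
    refine contDiff_iff_contDiffAt.2 fun x => ?_
    by_cases hx : x ∈ Metric.ball x₀ δ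
    · exact f.contDiffAt.smul (hball x hx)
    · have hx' : x ∉ tsupport f := by
        rw [f.tsupport_eq]
        intro h
        exact hx (Metric.mem_ball.2 ((Metric.mem_closedBall.1 h).trans_lt (half_lt_self hδ)))
      have h0 : (fun x => f x • A x) =ᶠ[𝓝 x] fun _ => 0 := by
        filter_upwards [notMem_tsupport_iff_eventuallyEq.1 hx'] with y hy
        simp [hy]
      exact contDiffAt_const.congr_of_eventuallyEq h0
  obtain ⟨C, hC⟩ := hcs.exists_bound_of_continuous hsm.continuous
  obtain ⟨L, hL⟩ := hsm.lipschitzWith_of_hasCompactSupport hcs one_ne_zero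
  refine ⟨_, C, L, hC, hL, ?_⟩
  filter_upwards [f.eventuallyEq_one] with x hx
  simp [hx]

end Extension

section Graphs

variable {n k : ℕ}

theorem add_coe_orthogonalProjectionOnto (W : Submodule ℝ (Euc n)) (v : Euc n) :
    (W.orthogonalProjectionOnto v : Euc n) + (Wᗮ.orthogonalProjectionOnto v : Euc n) = v :=
  W.starProjection_add_starProjection_orthogonal v

/-- Near the origin, the distribution consists of the graphs of a `C¹` family of linear maps from
`V 0` to its orthogonal complement. -/
theorem IsC1Distribution.exists_graph_near_zero {V : Euc n → Submodule ℝ (Euc n)}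
    (hV : IsC1Distribution k V) :
    ∃ A : Euc n → (V 0 →L[ℝ] (V 0)ᗮ), ContDiffAt ℝ 1 A 0 ∧
      ∀ᶠ z in 𝓝 0, ∀ v, v ∈ V z ↔
        (V 0)ᗮ.orthogonalProjectionOnto v = A z ((V 0).orthogonalProjectionOnto v) := by
  obtain ⟨U, hU, h0U, X, hX, hspan⟩ := hV.locally_spanned 0
  set P := (V 0).orthogonalProjectionOnto with hP
  set Q := (V 0)ᗮ.orthogonalProjectionOnto with hQ
  let Y : Euc n → ((Fin k → ℝ) →L[ℝ] Euc n) := fun z =>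
    ∑ i, (ContinuousLinearMap.proj i : (Fin k → ℝ) →L[ℝ] ℝ).smulRight (X i z)
  have hYapp : ∀ z c, Y z c = ∑ i, c i • X i z := fun z c => by
    simp [Y]
  have hmem : ∀ z ∈ U, ∀ v, v ∈ V z ↔ ∃ c, Y z c = v := fun z hz v => by
    rw [hspan z hz, Submodule.mem_span_range_iff_exists_fun]
    simp only [hYapp]
  have hYd : ContDiffAt ℝ 1 Y 0 := by
    refine ContDiffAt.sum fun i _ => ?_
    exact ((ContinuousLinearMap.smulRightL ℝ (Fin k → ℝ) (Euc n)
      (ContinuousLinearMap.proj i)).contDiff.contDiffAt).comp 0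
      ((hX i).contDiffAt (hU.mem_nhds h0U))
  let T : Euc n → ((Fin k → ℝ) →L[ℝ] V 0) := fun z => P.comp (Y z)
  have hTd : ContDiffAt ℝ 1 T 0 := contDiffAt_const.clm_comp hYd
  have hsurj : Function.Surjective (T 0) := fun w => by
    obtain ⟨c, hc⟩ := (hmem 0 h0U w).1 w.2
    refine ⟨c, ?_⟩
    simp only [T, ContinuousLinearMap.comp_apply, hc, hP]
    exact Submodule.orthogonalProjectionOnto_mem_subspace_eq_self w
  have hinj : Function.Injective (T 0) :=
    (LinearMap.injective_iff_surjective_of_finrank_eq_finrank (f := (T 0).toLinearMap)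
      (by rw [hV.finrank_eq, Module.finrank_fin_fun])).2 hsurj
  let e : (Fin k → ℝ) ≃L[ℝ] V 0 :=
    (LinearEquiv.ofBijective (T 0).toLinearMap ⟨hinj, hsurj⟩).toContinuousLinearEquiv
  have he : (e : (Fin k → ℝ) →L[ℝ] V 0) = T 0 := by ext; rfl
  have hinv : ContDiffAt ℝ 1 (fun z => (T z).inverse) 0 := by
    have := contDiffAt_map_inverse (𝕜 := ℝ) (n := 1) e
    rw [he] at this
    exact this.comp 0 hTd
  refine ⟨fun z => (Q.comp (Y z)).comp (T z).inverse,
    (contDiffAt_const.clm_comp hYd).clm_comp hinv, ?_⟩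
  have hrange : ∀ᶠ z in 𝓝 0, T z ∈ Set.range ((↑) : ((Fin k → ℝ) ≃L[ℝ] V 0) → _) :=
    hTd.continuousAt.eventually_mem (he ▸ ContinuousLinearEquiv.nhds e)
  filter_upwards [hrange, hU.mem_nhds h0U] with z hz hzU v
  obtain ⟨e', he'⟩ := hz
  have hTapp : ∀ c, P (Y z c) = e' c := fun c => (DFunLike.congr_fun he' c).symm
  rw [hmem z hzU, ← he', ContinuousLinearMap.inverse_equiv]
  simp only [ContinuousLinearMap.comp_apply, ContinuousLinearEquiv.coe_coe]
  constructor
  · rintro ⟨c, rfl⟩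
    rw [hTapp, ContinuousLinearEquiv.symm_apply_apply]
  · intro hv
    refine ⟨e'.symm (P v), ?_⟩
    have hPv : P (Y z (e'.symm (P v))) = P v := by
      rw [hTapp, ContinuousLinearEquiv.apply_symm_apply]
    have h := add_coe_orthogonalProjectionOnto (V 0) (Y z (e'.symm (P v)))
    rw [← hP, ← hQ, hPv, ← hv] at h
    exact h.symm.trans (add_coe_orthogonalProjectionOnto (V 0) v)

variable {W : Submodule ℝ (Euc n)}

theorem orthogonalProjectionOnto_add_coe (w : W) (y : Wᗮ) :
    W.orthogonalProjectionOnto ((w : Euc n) + y) = w := by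
  rw [map_add, Submodule.orthogonalProjectionOnto_mem_subspace_eq_self,
    Submodule.orthogonalProjectionOnto_apply_of_mem_orthogonal y.2, add_zero]

theorem orthogonalProjectionOnto_orthogonal_add_coe (w : W) (y : Wᗮ) :
    Wᗮ.orthogonalProjectionOnto ((w : Euc n) + y) = y := by
  rw [map_add, Submodule.orthogonalProjectionOnto_mem_subspace_eq_self,
    Submodule.orthogonalProjectionOnto_orthogonal_apply_eq_zero w.2, zero_add]

theorem mem_graphOver_univ {φ : W → Wᗮ} {z : Euc n} :
    z ∈ graphOver φ Set.univ ↔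
      Wᗮ.orthogonalProjectionOnto z = φ (W.orthogonalProjectionOnto z) := by
  constructor
  · rintro ⟨w, -, rfl⟩
    simp only [orthogonalProjectionOnto_add_coe, orthogonalProjectionOnto_orthogonal_add_coe]
  · intro h
    refine ⟨W.orthogonalProjectionOnto z, Set.mem_univ _, ?_⟩
    simp only [← h]
    exact add_coe_orthogonalProjectionOnto W z

theorem isClosed_graphOver_univ {φ : W → Wᗮ} (hφ : Continuous φ) :
    IsClosed (graphOver φ Set.univ) := by
  have : graphOver φ Set.univ = {z | Wᗮ.orthogonalProjectionOnto z
      = φ (W.orthogonalProjectionOnto z)} := Set.ext fun z => mem_graphOver_univ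
  rw [this]
  exact isClosed_eq (by fun_prop) (by fun_prop)

theorem IsC1Holder.isSubmanifoldC1Holder_graphOver {φ : W → Wᗮ} {α : ℝ≥0}
    (hW : Module.finrank ℝ W = k) (hφ : IsC1Holder α φ Set.univ) :
    IsSubmanifoldC1Holder k α (graphOver φ Set.univ) where
  isClosed := isClosed_graphOver_univ (contDiffOn_univ.1 hφ.contDiffOn).continuous
  locally_graph x _ := ⟨Set.univ, isOpen_univ, Set.mem_univ x, W, hW, Set.univ, φ, isOpen_univ, hφ,
    Set.inter_univ _⟩

/-- The tangent space of a graph is the graph of the differential. -/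
theorem mem_tangentVectors_graphOver_univ {φ : W → Wᗮ} {φ' : W →L[ℝ] Wᗮ} {w : W}
    (hφ : ContDiff ℝ 1 φ) (hw : HasFDerivAt φ φ' w) (v : Euc n) :
    v ∈ tangentVectors (graphOver φ Set.univ) ((w : Euc n) + φ w) ↔
      Wᗮ.orthogonalProjectionOnto v = φ' (W.orthogonalProjectionOnto v) := by
  constructor
  · rintro ⟨γ, -, hγ0, hγS, hγ⟩
    have h1 : HasDerivAt (fun t => Wᗮ.orthogonalProjectionOnto (γ t))
        (Wᗮ.orthogonalProjectionOnto v) 0 :=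
      (Wᗮ.orthogonalProjectionOnto).hasFDerivAt.comp_hasDerivAt 0 hγ
    have h2 : HasDerivAt (fun t => W.orthogonalProjectionOnto (γ t))
        (W.orthogonalProjectionOnto v) 0 :=
      (W.orthogonalProjectionOnto).hasFDerivAt.comp_hasDerivAt 0 hγ
    have hw' : HasFDerivAt φ φ' (W.orthogonalProjectionOnto (γ 0)) := by
      rwa [hγ0, orthogonalProjectionOnto_add_coe]
    refine h1.unique ((hw'.comp_hasDerivAt 0 h2).congr_of_eventuallyEq ?_)
    filter_upwards [hγS] with t ht
    exact mem_graphOver_univ.1 ht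
  · intro hv
    set p := W.orthogonalProjectionOnto v with hp
    have hline : ∀ t : ℝ, HasDerivAt (fun t : ℝ => w + t • p) p t := fun t => by
      simpa using ((hasDerivAt_id t).smul_const p).const_add w
    refine ⟨fun t => ((w + t • p : W) : Euc n) + (φ (w + t • p) : Euc n), ?_, by simp,
      Eventually.of_forall fun t => ⟨w + t • p, Set.mem_univ _, rfl⟩, ?_⟩
    · have hl : ContDiff ℝ 1 fun t : ℝ => w + t • p := by fun_prop
      exact ((W.subtypeL.contDiff.comp hl).add
        (Wᗮ.subtypeL.contDiff.comp (hφ.comp hl))).contDiffAt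
    · have hw' : HasFDerivAt φ φ' (w + (0 : ℝ) • p) := by simpa using hw
      have := ((W.subtypeL).hasFDerivAt.comp_hasDerivAt 0 (hline 0)).add
        ((Wᗮ.subtypeL).hasFDerivAt.comp_hasDerivAt 0 (hw'.comp_hasDerivAt 0 (hline 0)))
      rw [← hv] at this
      exact this.congr_deriv (add_coe_orthogonalProjectionOnto W v)

end Graphs

theorem hausdorffMeasure_pi_fatCantor_pos (k : ℕ) :
    0 < Measure.hausdorffMeasure (k : ℝ) (Set.pi Set.univ fun _ : Fin k => fatCantor) := by
  have h := hausdorffMeasure_pi_real (ι := Fin k)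
  rw [Fintype.card_fin] at h
  rw [h, volume_pi_pi, Finset.prod_const]
  exact ENNReal.pow_pos volume_fatCantor_pos _

/-! ### Construction of the submanifold -/

theorem holderOnWith_univ_of_norm_sub_le {X Y : Type*} [SeminormedAddCommGroup X]
    [SeminormedAddCommGroup Y] {f : X → Y} {H : ℝ} {α : ℝ≥0} (hH : 0 ≤ H)
    (hf : ∀ x y, ‖f x - f y‖ ≤ H * ‖x - y‖ ^ (α : ℝ)) :
    HolderOnWith H.toNNReal α f Set.univ := by
  intro x _ y _
  have h : (H.toNNReal : ENNReal) = ENNReal.ofReal H := rfl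
  rw [h, edist_dist, edist_dist, dist_eq_norm, dist_eq_norm,
    ENNReal.ofReal_rpow_of_nonneg (norm_nonneg (x - y)) α.coe_nonneg, ← ENNReal.ofReal_mul hH]
  exact ENNReal.ofReal_le_ofReal (hf x y)

theorem mainTheorem6 (n k : ℕ) (hk : 1 ≤ k) (V : Euc n → Submodule ℝ (Euc n))
    (hV : IsC1Distribution k V) :
    ∃ S : Set (Euc n),
      (∀ α : ℝ≥0, 0 < α → α < 1 → IsSubmanifoldC1Holder k α S) ∧
      0 < Measure.hausdorffMeasure (k : ℝ) (tangencySet S V) := by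
  obtain ⟨A₀, hA₀, hgraph⟩ := hV.exists_graph_near_zero
  obtain ⟨A, C, L, hAC, hAL, hAA⟩ := hA₀.exists_bounded_lipschitz_eventuallyEq
  obtain ⟨r, hr, hball⟩ := Metric.eventually_nhds_iff_ball.1 (hgraph.and hAA)
  let ι : V 0 ≃L[ℝ] (Fin k → ℝ) :=
    ContinuousLinearEquiv.ofFinrankEq (by rw [hV.finrank_eq, Module.finrank_fin_fun])
  set ι' : (Fin k → ℝ) →L[ℝ] V 0 := (ι.symm : (Fin k → ℝ) →L[ℝ] V 0) with hι'
  have hC : 0 ≤ C := (norm_nonneg (A 0)).trans (hAC 0)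
  -- The scale `l` is chosen so small that the whole graph over the unit cube, shrunk by the
  -- factor `l`, lies in the ball where `A` describes the distribution.
  set R : ℝ := ‖ι'‖ + 4 * (C * ‖ι'‖) with hR
  have hR0 : 0 ≤ R := by positivity
  set l : ℝ := r / (R + 1) with hl
  have hl0 : 0 < l := by positivity
  have hlR : l * R < r := by
    rw [hl, div_mul_eq_mul_div, div_lt_iff₀ (by positivity)]
    nlinarith
  let pt : (Fin k → ℝ) → (V 0)ᗮ → Euc n := fun x y => l • ((ι' x : Euc n) + (y : Euc n))
  obtain ⟨φ, φ', hφ, hφ0, ⟨C', hφ1⟩, hφα, hφK⟩ :=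
    exists_differential_eq_on_fatCantor (A := fun x y => (A (pt x y)).comp ι')
      (C₀ := C * ‖ι'‖) (L := L * (l * (‖ι'‖ + 1)) * ‖ι'‖) (by positivity)
      (fun x y => (ContinuousLinearMap.opNorm_comp_le _ _).trans (by gcongr; exact hAC _))
      (fun x y x' y' => by
        rw [← ContinuousLinearMap.sub_comp]
        refine (ContinuousLinearMap.opNorm_comp_le _ _).trans ?_
        have h1 : ‖pt x y - pt x' y'‖ ≤ l * (‖ι'‖ * ‖x - x'‖ + ‖y - y'‖) := by
          have : pt x y - pt x' y' = l • ((ι' (x - x') : Euc n) + ((y - y' : (V 0)ᗮ) : Euc n)) := by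
            simp only [pt, map_sub, Submodule.coe_sub]
            module
          rw [this, norm_smul, Real.norm_of_nonneg hl0.le]
          gcongr
          exact (norm_add_le _ _).trans (add_le_add (ι'.le_opNorm _) le_rfl)
        calc _ ≤ (L * (l * (‖ι'‖ * ‖x - x'‖ + ‖y - y'‖))) * ‖ι'‖ := by
              gcongr
              exact (hAL.norm_sub_le _ _).trans (by gcongr)
          _ ≤ (L * (l * ((‖ι'‖ + 1) * ‖x - x'‖ + (‖ι'‖ + 1) * ‖y - y'‖))) * ‖ι'‖ := by
              gcongr
              · linarith
              · exact le_mul_of_one_le_left (norm_nonneg _) (by linarith [norm_nonneg ι'])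
          _ = _ := by ring)
  set κ : V 0 →L[ℝ] (Fin k → ℝ) := l⁻¹ • (ι : V 0 →L[ℝ] (Fin k → ℝ)) with hκ
  have hκι : ∀ x, κ (l • ι' x) = x := fun x => by
    simp [hκ, hι', hl0.ne']
  let ψ : V 0 → (V 0)ᗮ := fun w => l • φ (κ w)
  let ψ' : V 0 → (V 0 →L[ℝ] (V 0)ᗮ) := fun w => (φ' (κ w)).comp (ι : V 0 →L[ℝ] (Fin k → ℝ))
  have hψ : ∀ w, HasFDerivAt ψ (ψ' w) w := fun w => by
    refine (((hφ (κ w)).comp w κ.hasFDerivAt).const_smul l).congr_fderiv ?_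
    ext v
    simp [ψ', hκ, hl0.ne']
  have hfd : fderiv ℝ ψ = ψ' := funext fun w => (hψ w).fderiv
  have hψα : ∀ α : ℝ≥0, 0 < α → α < 1 → ∃ H : ℝ≥0, HolderOnWith H α ψ' Set.univ := by
    intro α h0 h1
    obtain ⟨H, hH0, hH⟩ := hφα α (by exact_mod_cast h0) (by exact_mod_cast h1)
    refine ⟨_, holderOnWith_univ_of_norm_sub_le
      (H := H * ‖κ‖ ^ (α : ℝ) * ‖(ι : V 0 →L[ℝ] (Fin k → ℝ))‖) (by positivity) fun w w' => ?_⟩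
    rw [← ContinuousLinearMap.sub_comp]
    refine (ContinuousLinearMap.opNorm_comp_le _ _).trans ?_
    calc _ ≤ (H * (‖κ‖ * ‖w - w'‖) ^ (α : ℝ)) * ‖(ι : V 0 →L[ℝ] (Fin k → ℝ))‖ := by
          gcongr
          refine (hH _ _).trans ?_
          gcongr
          rw [← map_sub]
          exact κ.le_opNorm _
      _ = _ := by
          rw [Real.mul_rpow (norm_nonneg κ) (norm_nonneg (w - w'))]
          ring
  have hψc : ContDiff ℝ 1 ψ := by
    obtain ⟨H, hH⟩ := hψα (1 / 2) (by norm_num) (by norm_num)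
    refine contDiff_one_iff_fderiv.2 ⟨fun w => (hψ w).differentiableAt, ?_⟩
    rw [hfd, ← continuousOn_univ]
    exact hH.continuousOn (by norm_num)
  refine ⟨graphOver ψ Set.univ, fun α h0 h1 =>
    IsC1Holder.isSubmanifoldC1Holder_graphOver (hV.finrank_eq 0)
      ⟨hψc.contDiffOn, ⟨l * (4 * (C * ‖ι'‖)), fun w _ => ?_⟩,
        ⟨C' * ‖(ι : V 0 →L[ℝ] (Fin k → ℝ))‖, fun w _ => ?_⟩, hfd ▸ hψα α h0 h1⟩, ?_⟩
  · rw [norm_smul, Real.norm_of_nonneg hl0.le]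
    gcongr
    exact hφ0 _
  · rw [hfd]
    refine (ContinuousLinearMap.opNorm_comp_le _ _).trans ?_
    gcongr
    exact hφ1 _
  -- The tangency set projects, by a Lipschitz map, onto the product of fat Cantor sets.
  · set g : Euc n →L[ℝ] (Fin k → ℝ) := κ.comp (V 0).orthogonalProjectionOnto with hg
    have hsub : (Set.pi Set.univ fun _ : Fin k => fatCantor)
        ⊆ g '' tangencySet (graphOver ψ Set.univ) V := by
      intro x hx
      set w : V 0 := l • ι' x with hw
      have hκw : κ w = x := hκι x
      have hz : ((w : Euc n) + ψ w) = pt x (φ x) := by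
        simp only [ψ, pt, Submodule.coe_smul, smul_add, hw, hκι]
      have hzball : pt x (φ x) ∈ Metric.ball 0 r := by
        rw [mem_ball_zero_iff, norm_smul, Real.norm_of_nonneg hl0.le]
        refine lt_of_le_of_lt (mul_le_mul_of_nonneg_left ?_ hl0.le) hlR
        have hx1 : ‖x‖ ≤ 1 := (pi_norm_le_iff_of_nonneg zero_le_one).2 fun i => by
          have := (hx i (Set.mem_univ i)).1
          rw [Real.norm_of_nonneg this.1]
          exact this.2.le
        refine (norm_add_le _ _).trans (add_le_add ?_ (hφ0 x))
        exact (ι'.le_opNorm x).trans (mul_le_of_le_one_right (norm_nonneg ι') hx1)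
      obtain ⟨hmem, hAeq⟩ := hball _ hzball
      have hψw : ψ' w = A₀ (pt x (φ x)) := by
        simp only [ψ', hκw, hφK x hx, hAeq]
        ext v
        simp [hι']
      refine ⟨(w : Euc n) + ψ w, ⟨⟨w, Set.mem_univ _, rfl⟩, ?_⟩, ?_⟩
      · ext v
        rw [mem_tangentVectors_graphOver_univ hψc (hψ w), hψw, hz]
        exact (hmem v).symm
      · rw [hg, ContinuousLinearMap.comp_apply, orthogonalProjectionOnto_add_coe, hκw]
    rw [pos_iff_ne_zero]
    intro h0
    have h1 := (measure_mono hsub).trans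
      (g.lipschitz.hausdorffMeasure_image_le (d := (k : ℝ)) (Nat.cast_nonneg k)
        (tangencySet (graphOver ψ Set.univ) V))
    rw [h0, mul_zero] at h1
    exact (hausdorffMeasure_pi_fatCantor_pos k).not_ge h1
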